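/- Let $\ell$ be a prime number and let $K/\mathbb{Q}$ be a finite Galois extension together with an injective group homomorphism $\chi\colon \operatorname{Gal}(K/\mathbb{Q}) \to \mathbb{F}_\ell^\times$, by which the Galois group is regarded as a subgroup of $\mathbb{F}_\ell^\times$. Let $S$ be a finite set of prime numbers, and let $S' \subset S$ be the subset of primes that are totally split in $K$. Define \[ K(S,\ell) = \{\alpha (K^\times)^\ell : \ell \mid v_{\mathfrak p}(\alpha) \text{ for all primes } \mathfrak p \text{ of } K \text{ not above some } p \in S\} \subset K^\times/(K^\times)^\ell , \] and let $K(S,\ell)^{(1)}$ be the subgroup of those $z \in K(S,\ell)$ such that $\sigma(z) = z^{\chi(\sigma)}$ for all $\sigma \in \operatorname{Gal}(K/\mathbb{Q})$. Assume that $\ell$ does not divide the class number $h_K$ of $K$. Then $K(S,\ell)^{(1)}$ is a finite-dimensional $\mathbb{F}_\ell$-vector space. If $K$ is totally real and $K \neq \mathbb{Q}$, or if $K = \mathbb{Q}(\mu_\ell)$ and $\chi$ is given by the standard action on $\mu_\ell$ (that is, $\sigma(\zeta) = \zeta^{\chi(\sigma)}$ for all $\zeta \in \mu_\ell$ and all $\sigma$),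 then \[ \dim_{\mathbb{F}_\ell} K(S,\ell)^{(1)} = \#S' + 1 . \] In all other cases, \[ \dim_{\mathbb{F}_\ell} K(S,\ell)^{(1)} = \#S' . \] -/

import Mathlib

open NumberField

namespace KSl

noncomputable section

/-- The group `Kˣ / (Kˣ)^ℓ`, written additively. -/
def PowQuot (K : Type*) [Field K] (ℓ : ℕ) : Type _ :=
  Additive (Kˣ ⧸ (powMonoidHom ℓ : Kˣ →* Kˣ).range)

instance powQuotAddCommGroup (K : Type*) [Field K] (ℓ : ℕ) : AddCommGroup (PowQuot K ℓ) :=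
  inferInstanceAs (AddCommGroup (Additive (Kˣ ⧸ (powMonoidHom ℓ : Kˣ →* Kˣ).range)))

/-- `Kˣ / (Kˣ)^ℓ` is killed by `ℓ`, hence it is a module over `ℤ/ℓℤ`; the class `a` acts
as `z ↦ z ^ a`. -/
instance powQuotModule (K : Type*) [Field K] (ℓ : ℕ) : Module (ZMod ℓ) (PowQuot K ℓ) :=
  AddCommGroup.zmodModule (G := PowQuot K ℓ) (n := ℓ) (fun x => by
    have key : ∀ z : Kˣ ⧸ (powMonoidHom ℓ : Kˣ →* Kˣ).range, z ^ ℓ = 1 := fun z => by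
      obtain ⟨y, rfl⟩ := QuotientGroup.mk_surjective z
      rw [← QuotientGroup.mk_pow, QuotientGroup.eq_one_iff]
      exact ⟨y, rfl⟩
    exact key (Additive.toMul x))

/-- The class of `x ∈ Kˣ` in `Kˣ / (Kˣ)^ℓ`. -/
def powClass {K : Type*} [Field K] (ℓ : ℕ) (x : Kˣ) : PowQuot K ℓ :=
  Additive.ofMul (QuotientGroup.mk x)

/-- The action of an automorphism `σ` of `K` on `Kˣ / (Kˣ)^ℓ`. -/
def galAct {K : Type*} [Field K] [NumberField K] (ℓ : ℕ) (σ : Gal(K/ℚ)) :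
    PowQuot K ℓ →+ PowQuot K ℓ :=
  MonoidHom.toAdditive
    (QuotientGroup.map (powMonoidHom ℓ : Kˣ →* Kˣ).range (powMonoidHom ℓ : Kˣ →* Kˣ).range
      (Units.map (σ : K →* K)) (by
        rintro _ ⟨x, rfl⟩
        exact ⟨Units.map (σ : K →* K) x, by simp⟩))

/-- The action is induced by the action of `σ` on `Kˣ`. -/
theorem galAct_powClass {K : Type*} [Field K] [NumberField K] (ℓ : ℕ) (σ : Gal(K/ℚ)) (x : Kˣ) :
    galAct ℓ σ (powClass ℓ x) = powClass ℓ (Units.map (σ : K →* K) x) := rfl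

/-- The primes of `K` above some rational prime `p ∈ S`. -/
def primesAbove (K : Type*) [Field K] [NumberField K] (S : Finset ℕ) :
    Set (IsDedekindDomain.HeightOneSpectrum (𝓞 K)) :=
  {v | ∃ p ∈ S, v.asIdeal.LiesOver (Ideal.span {(p : ℤ)})}

/-- `K(S, ℓ)`: the classes of those `α ∈ Kˣ` such that `ℓ ∣ v_𝔭(α)` for all primes `𝔭` of `K`
not above some `p ∈ S`. -/
def selmer (K : Type*) [Field K] [NumberField K] (S : Finset ℕ) (ℓ : ℕ) :
    Submodule (ZMod ℓ) (PowQuot K ℓ) :=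
  AddSubgroup.toZModSubmodule (M := PowQuot K ℓ) ℓ (Subgroup.toAddSubgroup
    (IsDedekindDomain.selmerGroup (R := 𝓞 K) (K := K) (S := primesAbove K S) (n := ℓ)))

/-- The class of `x` lies in `K(S, ℓ)` iff `ℓ ∣ v_𝔭(x)` for all `𝔭` not above some `p ∈ S`. -/
theorem powClass_mem_selmer {K : Type*} [Field K] [NumberField K] (S : Finset ℕ) (ℓ : ℕ)
    (x : Kˣ) : powClass ℓ x ∈ selmer K S ℓ ↔ ∀ v : IsDedekindDomain.HeightOneSpectrum (𝓞 K),
      v ∉ primesAbove K S → (ℓ : ℤ) ∣ Multiplicative.toAdd (v.valuationOfNeZero x) := by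
  refine forall_congr' fun v => forall_congr' fun _ => ?_
  have h : v.valuationOfNeZeroMod ℓ (QuotientGroup.mk x) =
      Multiplicative.ofAdd ((Multiplicative.toAdd (v.valuationOfNeZero x) : ℤ) : ZMod ℓ) := rfl
  rw [← ZMod.intCast_zmod_eq_zero_iff_dvd]
  exact Eq.congr_left h

/-- `K(S, ℓ)^{(1)}`: the subspace of `K(S, ℓ)` on which every `σ` in the Galois group acts as
`z ↦ z ^ χ(σ)`, where `χ` identifies the Galois group with a subgroup of `(ℤ/ℓℤ)ˣ`. -/
def selmerOne (K : Type*) [Field K] [NumberField K] (S : Finset ℕ) (ℓ : ℕ)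
    (χ : Gal(K/ℚ) →* (ZMod ℓ)ˣ) : Submodule (ZMod ℓ) (PowQuot K ℓ) where
  carrier := {z | z ∈ selmer K S ℓ ∧ ∀ σ : Gal(K/ℚ), galAct ℓ σ z = (χ σ : ZMod ℓ) • z}
  zero_mem' := ⟨zero_mem _, fun σ => by rw [map_zero, smul_zero]⟩
  add_mem' := fun hx hy => ⟨add_mem hx.1 hy.1, fun σ => by
    rw [map_add, hx.2 σ, hy.2 σ, smul_add]⟩
  smul_mem' := fun c z hz => ⟨Submodule.smul_mem _ c hz.1, fun σ => by
    rw [ZMod.map_smul (galAct ℓ σ) c z, hz.2 σ, smul_comm]⟩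

/-- The rational prime `p` is totally split in `K`: there are `[K : ℚ]` distinct primes of `K`
above `p`. -/
def TotallySplit (K : Type*) [Field K] [NumberField K] (p : ℕ) : Prop :=
  ((Ideal.span {(p : ℤ)}).primesOver (𝓞 K)).ncard = Module.finrank ℚ K

/-- `K = ℚ(μ_ℓ)`, and `χ` is given by the standard action on `μ_ℓ`: `σ ζ = ζ ^ χ(σ)`. -/
def IsStandardCyclotomic (K : Type*) [Field K] [NumberField K] (ℓ : ℕ)
    (χ : Gal(K/ℚ) →* (ZMod ℓ)ˣ) : Prop :=
  IsCyclotomicExtension {ℓ} ℚ K ∧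
    ∀ (σ : Gal(K/ℚ)) (ζ : K), ζ ^ ℓ = 1 → σ ζ = ζ ^ (χ σ : ZMod ℓ).val

end

end KSl

/-! Two computations give the dimension: valuations at `S`, then units.

On the `χ`-part the valuation mod `ℓ` at `v` determines those at all conjugates of `v`. If some `σ ≠
1` fixes `v`, then `χ σ ≠ 1` forces that valuation to vanish, so only totally split primes
contribute. Each of them does contribute once: `v ^ h` is principal, `h` is invertible mod `ℓ`, and
a generator can be projected to the `χ`-part. Hence `S` adds exactly `#S'` to the dimension for the
empty set (`finrank_selmerOne_eq_add`).

Since `ℓ ∤ h`, the classes in `K(∅, ℓ)` are classes of units. If `K` is not totally real, complex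
conjugation is central, acts as `-1` on the `χ`-part, and `u / ū` is a root of unity; so the
`χ`-part comes from roots of unity, as it trivially does for `K = ℚ`. It is then nonzero only in the
standard cyclotomic case. If `K ≠ ℚ` is totally real of degree `n`, then `ℓ` is odd and a generator
`g` of the Galois group acts on units modulo torsion with characteristic polynomial `1 + X + ⋯ + X ^
(n - 1)` (`charpoly_galLattice`). Its reduction mod `ℓ` is separable and has `χ g ≠ 1` as a root, so
the eigenspace is a line. -/

namespace KSl

open IsDedekindDomain Pointwise Polynomial TensorProduct

/-! ### Classes modulo `ℓ`-th powers -/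

section PowQuot

variable {K : Type*} [Field K] {ℓ : ℕ}

theorem powClass_surjective : Function.Surjective (powClass ℓ : Kˣ → PowQuot K ℓ) :=
  fun z => QuotientGroup.mk_surjective (Additive.toMul z)

theorem powClass_mul (x y : Kˣ) : powClass ℓ (x * y) = powClass ℓ x + powClass ℓ y := rfl

theorem powClass_pow (x : Kˣ) (m : ℕ) : powClass ℓ (x ^ m) = m • powClass ℓ x := rfl

theorem powClass_zpow (x : Kˣ) (m : ℤ) : powClass ℓ (x ^ m) = m • powClass ℓ x := rfl

theorem powClass_inv (x : Kˣ) : powClass ℓ x⁻¹ = -powClass ℓ x := rfl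

theorem powClass_eq_zero_iff {x : Kˣ} : powClass ℓ x = 0 ↔ ∃ y : Kˣ, y ^ ℓ = x :=
  QuotientGroup.eq_one_iff x

theorem intCast_smul (m : ℤ) (z : PowQuot K ℓ) : (m : ZMod ℓ) • z = m • z :=
  Int.cast_smul_eq_zsmul _ _ _

theorem natCast_smul (m : ℕ) (z : PowQuot K ℓ) : (m : ZMod ℓ) • z = m • z :=
  Nat.cast_smul_eq_nsmul _ _ _

end PowQuot

/-! ### Valuations modulo `ℓ` and the Galois action on primes -/

section Valuations

variable {K : Type*} [Field K] [NumberField K] {ℓ : ℕ}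

/-- The `v`-adic valuation modulo `ℓ`, as a linear form on `Kˣ / (Kˣ)^ℓ`. -/
noncomputable def ord (v : HeightOneSpectrum (𝓞 K)) : PowQuot K ℓ →ₗ[ZMod ℓ] ZMod ℓ :=
  AddMonoidHom.toZModLinearMap ℓ
    (MonoidHom.toAdditive (v.valuationOfNeZeroMod (K := K) ℓ) : PowQuot K ℓ →+ ZMod ℓ)

theorem ord_powClass (v : HeightOneSpectrum (𝓞 K)) (x : Kˣ) :
    ord v (powClass ℓ x) = ((Multiplicative.toAdd (v.valuationOfNeZero x) : ℤ) : ZMod ℓ) := rfl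

theorem mem_selmer_iff {S : Finset ℕ} {z : PowQuot K ℓ} :
    z ∈ selmer K S ℓ ↔ ∀ v ∉ primesAbove K S, ord v z = 0 :=
  Iff.rfl

instance : MulAction Gal(K/ℚ) (HeightOneSpectrum (𝓞 K)) where
  smul σ v := ⟨σ • v.asIdeal, inferInstance, fun h => v.ne_bot (by
    rw [← inv_smul_smul σ v.asIdeal, h, Ideal.pointwise_smul_def, Ideal.map_bot])⟩
  one_smul v := HeightOneSpectrum.ext (one_smul _ v.asIdeal)
  mul_smul σ τ v := HeightOneSpectrum.ext (mul_smul σ τ v.asIdeal)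

theorem smul_asIdeal (σ : Gal(K/ℚ)) (v : HeightOneSpectrum (𝓞 K)) :
    (σ • v).asIdeal = σ • v.asIdeal := rfl

theorem intValuation_smul (σ : Gal(K/ℚ)) (v : HeightOneSpectrum (𝓞 K)) (r : 𝓞 K) :
    (σ • v).intValuation (σ • r) = v.intValuation r := by
  rcases eq_or_ne r 0 with rfl | hr
  · simp
  have hr' : σ • r ≠ 0 := by simpa [smul_eq_zero_iff_eq] using hr
  rw [HeightOneSpectrum.intValuation_eq_exp_neg_multiplicity _ hr,
    HeightOneSpectrum.intValuation_eq_exp_neg_multiplicity _ hr', smul_asIdeal]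
  have h : Ideal.span {σ • r} = σ • Ideal.span {r} := by
    rw [Ideal.pointwise_smul_def, Ideal.map_span, Set.image_singleton]; rfl
  rw [h]
  congr 3
  exact multiplicity_map_eq (MulDistribMulAction.toMulEquiv (Ideal (𝓞 K)) σ)

theorem valuation_smul (σ : Gal(K/ℚ)) (v : HeightOneSpectrum (𝓞 K)) (x : K) :
    (σ • v).valuation K (σ x) = v.valuation K x := by
  obtain ⟨a, b, -, rfl⟩ := IsFractionRing.div_surjective (A := 𝓞 K) x
  have h (r : 𝓞 K) : σ (algebraMap (𝓞 K) K r) = algebraMap (𝓞 K) K (σ • r) := rfl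
  simp only [map_div₀, h, HeightOneSpectrum.valuation_of_algebraMap, intValuation_smul]

theorem ord_smul_galAct (σ : Gal(K/ℚ)) (v : HeightOneSpectrum (𝓞 K)) (z : PowQuot K ℓ) :
    ord (σ • v) (galAct ℓ σ z) = ord v z := by
  obtain ⟨x, rfl⟩ := powClass_surjective z
  rw [galAct_powClass, ord_powClass, ord_powClass]
  congr 2
  rw [← WithZero.coe_inj, HeightOneSpectrum.valuationOfNeZero_eq,
    HeightOneSpectrum.valuationOfNeZero_eq]
  exact valuation_smul σ v x

theorem ord_galAct (σ : Gal(K/ℚ)) (v : HeightOneSpectrum (𝓞 K)) (z : PowQuot K ℓ) :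
    ord v (galAct ℓ σ z) = ord (σ⁻¹ • v) z := by
  conv_lhs => rw [← smul_inv_smul σ v, ord_smul_galAct]

/-- Take a generator of the principal ideal `v ^ h`. The sign appears because the multiplicative
valuation is the exponential of minus the multiplicity. -/
theorem exists_ord_eq_classNumber (v : HeightOneSpectrum (𝓞 K)) :
    ∃ z : PowQuot K ℓ, ord v z = -(classNumber K : ZMod ℓ) ∧ ∀ w ≠ v, ord w z = 0 := by
  have hI : v.asIdeal ∈ nonZeroDivisors (Ideal (𝓞 K)) := mem_nonZeroDivisors_of_ne_zero v.ne_bot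
  have hI' := pow_mem hI (classNumber K)
  have h1 : ClassGroup.mk0 ⟨v.asIdeal ^ classNumber K, hI'⟩ = 1 := by
    have : (⟨v.asIdeal ^ classNumber K, hI'⟩ : nonZeroDivisors (Ideal (𝓞 K))) =
      ⟨v.asIdeal, hI⟩ ^ classNumber K := rfl
    rw [this, map_pow]
    exact pow_card_eq_one
  obtain ⟨⟨a, ha⟩⟩ := (ClassGroup.mk0_eq_one_iff hI').1 h1
  have ha' : Ideal.span {a} = v.asIdeal ^ classNumber K := ha.symm
  have ha0 : a ≠ 0 := by
    rintro rfl
    rw [Ideal.span_singleton_zero] at ha'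
    exact pow_ne_zero _ v.ne_bot ha'.symm
  have hval (w : HeightOneSpectrum (𝓞 K)) (m : ℕ)
      (hm : multiplicity w.asIdeal (v.asIdeal ^ classNumber K) = m) :
      ord w (powClass ℓ (Units.mk0 (algebraMap (𝓞 K) K a) (by simpa using ha0))) =
        -(m : ZMod ℓ) := by
    have : w.valuationOfNeZero (Units.mk0 (algebraMap (𝓞 K) K a) (by simpa using ha0)) =
        Multiplicative.ofAdd (-(m : ℤ)) := by
      rw [← WithZero.coe_inj, HeightOneSpectrum.valuationOfNeZero_eq]
      rw [Units.val_mk0, HeightOneSpectrum.valuation_of_algebraMap,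
        HeightOneSpectrum.intValuation_eq_exp_neg_multiplicity _ ha0, ha', hm]
      rfl
    rw [ord_powClass, this]
    simp
  refine ⟨powClass ℓ (Units.mk0 (algebraMap (𝓞 K) K a) (by simpa using ha0)), ?_, fun w hw => ?_⟩
  · exact hval v _ (multiplicity_pow_self v.ne_bot (Ideal.isUnit_iff.not.2 v.isPrime.ne_top) _)
  · rw [hval w 0, Nat.cast_zero, neg_zero]
    rw [multiplicity_eq_zero]
    intro h
    have := (Ideal.prime_of_isPrime w.ne_bot w.isPrime).dvd_of_dvd_pow h
    exact hw (HeightOneSpectrum.ext (v.isMaximal.eq_of_le w.isPrime.ne_top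
      (Ideal.dvd_iff_le.1 this)).symm)

end Valuations

/-! ### Reduction to the case of empty `S` -/

section Reduction

variable {K : Type*} [Field K] [NumberField K] {ℓ : ℕ}

theorem galAct_one (z : PowQuot K ℓ) : galAct ℓ (1 : Gal(K/ℚ)) z = z := by
  obtain ⟨x, rfl⟩ := powClass_surjective z
  rfl

theorem galAct_mul (σ τ : Gal(K/ℚ)) (z : PowQuot K ℓ) :
    galAct ℓ (σ * τ) z = galAct ℓ σ (galAct ℓ τ z) := by
  obtain ⟨x, rfl⟩ := powClass_surjective z
  rfl

theorem galAct_smul (σ : Gal(K/ℚ)) (c : ZMod ℓ) (z : PowQuot K ℓ) :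
    galAct ℓ σ (c • z) = c • galAct ℓ σ z :=
  ZMod.map_smul _ _ _

theorem mem_selmerOne_iff {S : Finset ℕ} {χ : Gal(K/ℚ) →* (ZMod ℓ)ˣ} {z : PowQuot K ℓ} :
    z ∈ selmerOne K S ℓ χ ↔
      z ∈ selmer K S ℓ ∧ ∀ σ : Gal(K/ℚ), galAct ℓ σ z = (χ σ : ZMod ℓ) • z :=
  Iff.rfl

/-- The projection to the `χ`-isotypic part, up to the factor `#Gal(K/ℚ)`. -/
noncomputable def isotypicSum (χ : Gal(K/ℚ) →* (ZMod ℓ)ˣ) (z : PowQuot K ℓ) : PowQuot K ℓ :=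
  ∑ σ : Gal(K/ℚ), (χ σ⁻¹ : ZMod ℓ) • galAct ℓ σ z

theorem galAct_isotypicSum (χ : Gal(K/ℚ) →* (ZMod ℓ)ˣ) (τ : Gal(K/ℚ)) (z : PowQuot K ℓ) :
    galAct ℓ τ (isotypicSum χ z) = (χ τ : ZMod ℓ) • isotypicSum χ z := by
  rw [isotypicSum, map_sum, Finset.smul_sum]
  refine Fintype.sum_equiv (Equiv.mulLeft τ) _ _ fun σ => ?_
  rw [galAct_smul, ← galAct_mul, smul_smul, ← Units.val_mul, ← map_mul]
  simp

theorem ord_isotypicSum (χ : Gal(K/ℚ) →* (ZMod ℓ)ˣ) (v : HeightOneSpectrum (𝓞 K))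
    (z : PowQuot K ℓ) :
    ord v (isotypicSum χ z) = ∑ σ : Gal(K/ℚ), (χ σ : ZMod ℓ) * ord (σ • v) z := by
  rw [isotypicSum, map_sum]
  refine Fintype.sum_equiv (Equiv.inv _) _ _ fun σ => ?_
  rw [map_smul, ord_galAct, smul_eq_mul, Equiv.inv_apply]

theorem smul_mem_primesAbove {S : Finset ℕ} {v : HeightOneSpectrum (𝓞 K)}
    (hv : v ∈ primesAbove K S) (σ : Gal(K/ℚ)) : σ • v ∈ primesAbove K S := by
  obtain ⟨p, hp, h⟩ := hv
  refine ⟨p, hp, ?_⟩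
  rw [smul_asIdeal]
  infer_instance

omit [NumberField K] in
theorem eq_of_liesOver_of_liesOver {P : Ideal (𝓞 K)} {p q : ℕ}
    (hp : P.LiesOver (Ideal.span {(p : ℤ)})) (hq : P.LiesOver (Ideal.span {(q : ℤ)})) :
    p = q := by
  have h := hp.over.trans hq.over.symm
  rw [Ideal.span_singleton_eq_span_singleton, Int.associated_iff_natAbs] at h
  simpa using h

/-- Galois acts transitively on the primes above `p`, so by orbit-stabilizer there are `n` of them
exactly when the decomposition group is trivial. -/
theorem totallySplit_iff [IsGalois ℚ K] {p : ℕ} (hp : p.Prime) {v : HeightOneSpectrum (𝓞 K)}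
    (hv : v.asIdeal.LiesOver (Ideal.span {(p : ℤ)})) :
    TotallySplit K p ↔ ∀ σ : Gal(K/ℚ), σ • v = v → σ = 1 := by
  have hp' : (Ideal.span {(p : ℤ)}).IsPrime :=
    (Ideal.span_singleton_prime (by exact_mod_cast hp.ne_zero)).2 (Nat.prime_iff_prime_int.1 hp)
  have h1 : ((Ideal.span {(p : ℤ)}).primesOver (𝓞 K)).ncard *
      Nat.card (MulAction.stabilizer Gal(K/ℚ) v.asIdeal) = Module.finrank ℚ K := by
    rw [← Algebra.IsInvariant.orbit_eq_primesOver ℤ (𝓞 K) Gal(K/ℚ) _ v.asIdeal,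
      ← IsGalois.card_aut_eq_finrank]
    simpa using Nat.card_congr (MulAction.orbitProdStabilizerEquivGroup Gal(K/ℚ) v.asIdeal)
  have h0 : Module.finrank ℚ K ≠ 0 := Module.finrank_pos.ne'
  rw [TotallySplit]
  have h2 : ((Ideal.span {(p : ℤ)}).primesOver (𝓞 K)).ncard = Module.finrank ℚ K ↔
      Nat.card (MulAction.stabilizer Gal(K/ℚ) v.asIdeal) = 1 := by
    rw [← h1] at h0 ⊢
    rw [eq_comm, Nat.mul_eq_left (left_ne_zero_of_mul h0)]
  rw [h2, Subgroup.card_eq_one, Subgroup.eq_bot_iff_forall]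
  refine forall_congr' fun σ => ?_
  rw [MulAction.mem_stabilizer_iff, HeightOneSpectrum.ext_iff, smul_asIdeal]

theorem exists_liesOver_of_totallySplit {p : ℕ} (hp : p.Prime) (h : TotallySplit K p) :
    ∃ v : HeightOneSpectrum (𝓞 K), v.asIdeal.LiesOver (Ideal.span {(p : ℤ)}) := by
  have h0 : ((Ideal.span {(p : ℤ)}).primesOver (𝓞 K)).ncard ≠ 0 := by
    rw [TotallySplit] at h
    rw [h]
    exact Module.finrank_pos.ne'
  obtain ⟨P, hP, hPp⟩ := Set.nonempty_of_ncard_ne_zero h0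
  refine ⟨⟨P, hP, ?_⟩, hPp⟩
  exact Ideal.ne_bot_of_liesOver_of_ne_bot (p := Ideal.span {(p : ℤ)})
    (by simpa using hp.ne_zero) P

variable [Fact ℓ.Prime] {χ : Gal(K/ℚ) →* (ZMod ℓ)ˣ}

/-- Apply `isotypicSum` to a generator of `v ^ h`. As the stabilizer is trivial, only `σ = 1`
contributes at `v`, with the invertible value `-h`. -/
theorem exists_mem_selmerOne_ord (hh : ¬ ℓ ∣ classNumber K) {S : Finset ℕ}
    {v : HeightOneSpectrum (𝓞 K)} (hv : v ∈ primesAbove K S)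
    (hstab : ∀ σ : Gal(K/ℚ), σ • v = v → σ = 1) :
    ∃ z ∈ selmerOne K S ℓ χ, ord v z = 1 ∧
      ∀ w : HeightOneSpectrum (𝓞 K), (∀ σ : Gal(K/ℚ), σ • w ≠ v) → ord w z = 0 := by
  obtain ⟨y, hy, hy'⟩ := exists_ord_eq_classNumber (ℓ := ℓ) v
  have hc : (-(classNumber K : ZMod ℓ)) ≠ 0 := by
    rwa [neg_ne_zero, Ne, ZMod.natCast_eq_zero_iff]
  have hoff (w : HeightOneSpectrum (𝓞 K)) (hw : ∀ σ : Gal(K/ℚ), σ • w ≠ v) :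
      ord w (isotypicSum χ y) = 0 := by
    rw [ord_isotypicSum]
    exact Finset.sum_eq_zero fun σ _ => by rw [hy' _ (hw σ), mul_zero]
  refine ⟨(-(classNumber K : ZMod ℓ))⁻¹ • isotypicSum χ y, ⟨?_, fun τ => ?_⟩, ?_, fun w hw => ?_⟩
  · rw [mem_selmer_iff]
    intro w hw
    rw [map_smul, hoff w, smul_zero]
    rintro σ rfl
    apply hw
    simpa using smul_mem_primesAbove hv σ⁻¹
  · rw [galAct_smul, galAct_isotypicSum, smul_comm]
  · rw [map_smul, ord_isotypicSum, Finset.sum_eq_single 1]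
    · rw [map_one, one_smul, hy, Units.val_one, one_mul, smul_eq_mul, inv_mul_cancel₀ hc]
    · intro σ _ hσ
      rw [hy' _ fun h => hσ (hstab σ h), mul_zero]
    · simp
  · rw [map_smul, hoff w hw, smul_zero]

theorem ord_smul_of_mem_selmerOne {S : Finset ℕ} {z : PowQuot K ℓ} (hz : z ∈ selmerOne K S ℓ χ)
    (σ : Gal(K/ℚ)) (v : HeightOneSpectrum (𝓞 K)) :
    (χ σ : ZMod ℓ) * ord (σ • v) z = ord v z := by
  rw [← ord_smul_galAct σ v z, hz.2 σ, map_smul, smul_eq_mul]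

theorem ord_eq_zero_of_smul_eq (hχ : Function.Injective χ) {S : Finset ℕ} {z : PowQuot K ℓ}
    (hz : z ∈ selmerOne K S ℓ χ) {σ : Gal(K/ℚ)} (hσ : σ ≠ 1) {v : HeightOneSpectrum (𝓞 K)}
    (hv : σ • v = v) : ord v z = 0 := by
  have h := ord_smul_of_mem_selmerOne hz σ v
  rw [hv] at h
  by_contra h0
  refine hσ (hχ ?_)
  rw [map_one]
  exact Units.ext (mul_right_cancel₀ h0 (by rw [h, Units.val_one, one_mul]))

open scoped Classical in
/-- The valuations at one prime above each totally split prime of `S` cut out, inside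
`K(S, ℓ)^{(1)}`, the part that comes from units. -/
theorem finrank_selmerOne_eq_add [IsGalois ℚ K] (hχ : Function.Injective χ) (S : Finset ℕ)
    (hS : ∀ p ∈ S, p.Prime) (hh : ¬ ℓ ∣ classNumber K)
    [Module.Finite (ZMod ℓ) (selmerOne K ∅ ℓ χ)] :
    Module.Finite (ZMod ℓ) (selmerOne K S ℓ χ) ∧
      Module.finrank (ZMod ℓ) (selmerOne K S ℓ χ) =
        (S.filter fun p => TotallySplit K p).card +
          Module.finrank (ZMod ℓ) (selmerOne K ∅ ℓ χ) := by
  set T := S.filter fun p => TotallySplit K p with hT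
  have hex (p : T) : ∃ v : HeightOneSpectrum (𝓞 K),
      v.asIdeal.LiesOver (Ideal.span {((p : ℕ) : ℤ)}) := by
    have hp := Finset.mem_filter.1 p.2
    exact exists_liesOver_of_totallySplit (hS _ hp.1) hp.2
  choose v hv using hex
  let Φ : selmerOne K S ℓ χ →ₗ[ZMod ℓ] (T → ZMod ℓ) :=
    LinearMap.pi fun p => ord (v p) ∘ₗ (selmerOne K S ℓ χ).subtype
  have hle : selmerOne K ∅ ℓ χ ≤ selmerOne K S ℓ χ := fun z hz =>
    ⟨fun w _ => hz.1 w (by rintro ⟨p, hp, -⟩; simp at hp), hz.2⟩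
  have hker : LinearMap.ker Φ = (selmerOne K ∅ ℓ χ).comap (selmerOne K S ℓ χ).subtype := by
    ext ⟨z, hz⟩
    rw [LinearMap.mem_ker, Submodule.mem_comap, Submodule.subtype_apply]
    constructor
    · intro h
      refine ⟨mem_selmer_iff.2 fun w _ => ?_, hz.2⟩
      by_cases hw : w ∈ primesAbove K S
      swap
      · exact mem_selmer_iff.1 hz.1 w hw
      obtain ⟨p, hp, hwp⟩ := hw
      by_cases hsplit : TotallySplit K p
      · have hpT : p ∈ T := Finset.mem_filter.2 ⟨hp, hsplit⟩
        -- The chosen prime above `p` is conjugate to `w`, so the vanishing there transfers to `w`.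
        obtain ⟨σ, hσ⟩ := Ideal.exists_smul_eq_of_isGaloisGroup (Ideal.span {(p : ℤ)})
          w.asIdeal (v ⟨p, hpT⟩).asIdeal (G := Gal(K/ℚ)) (hQp := (v ⟨p, hpT⟩).isPrime)
        have hσ' : σ • w = v ⟨p, hpT⟩ := HeightOneSpectrum.ext hσ
        rw [← ord_smul_of_mem_selmerOne hz σ w, hσ']
        have := congrFun h ⟨p, hpT⟩
        change ord (v ⟨p, hpT⟩) z = 0 at this
        rw [this, mul_zero]
      · rw [totallySplit_iff (hS p hp) hwp] at hsplit
        push Not at hsplit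
        obtain ⟨σ, h1, h2⟩ := hsplit
        exact ord_eq_zero_of_smul_eq hχ hz h2 h1
    · intro h
      ext p
      exact mem_selmer_iff.1 h.1 (v p) (by rintro ⟨q, hq, -⟩; simp at hq)
  have hsurj : Function.Surjective Φ := by
    rw [← LinearMap.range_eq_top, eq_top_iff, ← (Pi.basisFun (ZMod ℓ) T).span_eq,
      Submodule.span_le]
    rintro _ ⟨p, rfl⟩
    have hp := Finset.mem_filter.1 p.2
    obtain ⟨z, hz, h1, h2⟩ := exists_mem_selmerOne_ord (χ := χ) hh (S := S) (v := v p)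
      ⟨p, hp.1, hv p⟩ ((totallySplit_iff (hS _ hp.1) (hv p)).1 hp.2)
    refine ⟨⟨z, hz⟩, ?_⟩
    ext q
    rw [Pi.basisFun_apply]
    change ord (v q) z = _
    rcases eq_or_ne q p with rfl | hq
    · rw [h1, Pi.single_eq_same]
    · rw [Pi.single_eq_of_ne hq, h2]
      intro σ hσ
      have : (σ • v q).asIdeal.LiesOver (Ideal.span {((q : ℕ) : ℤ)}) := by
        have := hv q
        rw [smul_asIdeal]
        infer_instance
      rw [hσ] at this
      exact hq (Subtype.ext (eq_of_liesOver_of_liesOver this (hv p)))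
  let e : selmerOne K ∅ ℓ χ ≃ₗ[ZMod ℓ] LinearMap.ker Φ :=
    (Submodule.comapSubtypeEquivOfLe hle).symm.trans (LinearEquiv.ofEq _ _ hker.symm)
  have : Module.Finite (ZMod ℓ) (LinearMap.ker Φ) := Module.Finite.equiv e
  have hfin : Module.Finite (ZMod ℓ) (selmerOne K S ℓ χ) := by
    have : Module.Finite (ZMod ℓ) (selmerOne K S ℓ χ ⧸ LinearMap.ker Φ) :=
      Module.Finite.equiv (Φ.quotKerEquivOfSurjective hsurj).symm
    exact Module.Finite.of_submodule_quotient (LinearMap.ker Φ)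
  refine ⟨hfin, ?_⟩
  rw [← Φ.finrank_range_add_finrank_ker, LinearMap.range_eq_top.2 hsurj, finrank_top,
    Module.finrank_fintype_fun_eq_card, e.finrank_eq, Fintype.card_coe]

end Reduction

/-! ### Units and `K(∅, ℓ)` -/

section Units

variable {K : Type*} [Field K] [NumberField K] {ℓ : ℕ}

section

omit [NumberField K]

/-- The class of a unit of `𝓞 K` in `Kˣ / (Kˣ)^ℓ`. -/
noncomputable def unitClass (ℓ : ℕ) (u : (𝓞 K)ˣ) : PowQuot K ℓ :=
  powClass ℓ (Units.map (algebraMap (𝓞 K) K : 𝓞 K →* K) u)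

theorem unitClass_mul (u v : (𝓞 K)ˣ) :
    unitClass ℓ (u * v) = unitClass ℓ u + unitClass ℓ v := by
  rw [unitClass, map_mul, powClass_mul]; rfl

theorem unitClass_pow (u : (𝓞 K)ˣ) (m : ℕ) : unitClass ℓ (u ^ m) = m • unitClass ℓ u := by
  rw [unitClass, map_pow, powClass_pow]; rfl

theorem unitClass_zpow (u : (𝓞 K)ˣ) (m : ℤ) : unitClass ℓ (u ^ m) = m • unitClass ℓ u := by
  rw [unitClass, map_zpow, powClass_zpow]; rfl

theorem unitClass_mul_inv (u v : (𝓞 K)ˣ) :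
    unitClass ℓ (u * v⁻¹) = unitClass ℓ u - unitClass ℓ v := by
  rw [unitClass_mul, sub_eq_add_neg, unitClass, unitClass, unitClass, map_inv, powClass_inv]

end

theorem galAct_unitClass (σ : Gal(K/ℚ)) (u : (𝓞 K)ˣ) :
    galAct ℓ σ (unitClass ℓ u) =
      unitClass ℓ (Units.map (MulSemiringAction.toRingHom Gal(K/ℚ) (𝓞 K) σ : 𝓞 K →* 𝓞 K) u) := by
  rw [unitClass, galAct_powClass, unitClass]
  congr 1

theorem unitClass_mem_selmer (S : Finset ℕ) (u : (𝓞 K)ˣ) : unitClass ℓ u ∈ selmer K S ℓ := by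
  rw [unitClass, powClass_mem_selmer]
  intro v _
  simp

theorem exists_unit_of_valuationOfNeZero {x : Kˣ}
    (h : ∀ v : HeightOneSpectrum (𝓞 K), v.valuationOfNeZero x = 1) :
    ∃ u : (𝓞 K)ˣ, Units.map (algebraMap (𝓞 K) K : 𝓞 K →* K) u = x := by
  have hint (y : Kˣ) (hy : ∀ v : HeightOneSpectrum (𝓞 K), v.valuationOfNeZero y = 1) :
      ∃ a : 𝓞 K, algebraMap (𝓞 K) K a = y := by
    refine HeightOneSpectrum.mem_integers_of_valuation_le_one K (y : K) fun v => ?_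
    rw [← HeightOneSpectrum.valuationOfNeZero_eq, hy v]
    rfl
  obtain ⟨a, ha⟩ := hint x h
  obtain ⟨b, hb⟩ := hint x⁻¹ fun v => by rw [map_inv, h v, inv_one]
  have hab : a * b = 1 := by
    apply FaithfulSMul.algebraMap_injective (𝓞 K) K
    rw [map_mul, ha, hb, map_one, Units.mul_inv]
  exact ⟨⟨a, b, hab, by rw [mul_comm, hab]⟩, Units.ext ha⟩

theorem unitClass_eq_zero_iff [Fact ℓ.Prime] {u : (𝓞 K)ˣ} :
    unitClass ℓ u = 0 ↔ ∃ w : (𝓞 K)ˣ, w ^ ℓ = u := by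
  rw [unitClass, powClass_eq_zero_iff]
  constructor
  · rintro ⟨y, hy⟩
    obtain ⟨w, rfl⟩ := exists_unit_of_valuationOfNeZero (x := y) fun v => by
      have h := congrArg v.valuationOfNeZero hy
      rw [HeightOneSpectrum.valuation_of_unit_eq, map_pow] at h
      have h2 := congrArg Multiplicative.toAdd h
      rw [toAdd_pow, toAdd_one, smul_eq_zero] at h2
      exact h2.resolve_left (Fact.out : ℓ.Prime).ne_zero
    refine ⟨w, ?_⟩
    rw [← map_pow] at hy
    exact Units.map_injective (FaithfulSMul.algebraMap_injective (𝓞 K) K) hy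
  · rintro ⟨w, rfl⟩
    exact ⟨_, (map_pow _ _ _).symm⟩

-- Divide every exponent in the prime factorization of the ideal by `ℓ`.
open UniqueFactorizationMonoid in
theorem exists_pow_eq_span_singleton {r : 𝓞 K} (hr : r ≠ 0)
    (h : ∀ v : HeightOneSpectrum (𝓞 K), ℓ ∣ multiplicity v.asIdeal (Ideal.span {r})) :
    ∃ I : Ideal (𝓞 K), I ^ ℓ = Ideal.span {r} := by
  classical
  have h0 : Ideal.span {r} ≠ 0 := by simpa using hr
  obtain ⟨u, hu⟩ := Multiset.exists_smul_of_dvd_count (normalizedFactors (Ideal.span {r}))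
    (k := ℓ) fun P hP => by
      have hPp := prime_of_normalized_factor P hP
      have := h ⟨P, Ideal.isPrime_of_prime hPp, hPp.ne_zero⟩
      rwa [← HeightOneSpectrum.count_normalizedFactors_eq_multiplicity h0] at this
  exact ⟨u.prod, by rw [← Multiset.prod_nsmul, ← hu, Ideal.prod_normalizedFactors_eq_self h0]⟩

/-- If `ℓ` does not divide the class number then `K(∅, ℓ)` consists of the classes of units. -/
theorem exists_unitClass_eq [Fact ℓ.Prime] (hh : ¬ ℓ ∣ classNumber K) {z : PowQuot K ℓ}
    (hz : z ∈ selmer K ∅ ℓ) : ∃ u : (𝓞 K)ˣ, unitClass ℓ u = z := by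
  have hℓ : ℓ.Prime := Fact.out
  have hclass (x y w : Kˣ) (hxy : x = w * y ^ ℓ) : powClass ℓ x = powClass ℓ w := by
    rw [hxy, powClass_mul, powClass_eq_zero_iff.2 ⟨y, rfl⟩, add_zero]
  obtain ⟨x, rfl⟩ := powClass_surjective z
  obtain ⟨a, b, hb, hx⟩ := IsFractionRing.div_surjective (A := 𝓞 K) (x : K)
  have hb0 : b ≠ 0 := nonZeroDivisors.ne_zero hb
  have hbK : algebraMap (𝓞 K) K b ≠ 0 := by simpa using hb0
  -- Multiplying `x = a / b` by `b ^ ℓ` gives an integral representative of the same class.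
  have hr0 : a * b ^ (ℓ - 1) ≠ 0 := by
    refine mul_ne_zero ?_ (pow_ne_zero _ hb0)
    rintro rfl
    exact x.ne_zero (by rw [← hx, map_zero, zero_div])
  set r := a * b ^ (ℓ - 1) with hr
  have hrK : algebraMap (𝓞 K) K r ≠ 0 := by simpa using hr0
  have hrx : Units.mk0 _ hrK = x * Units.mk0 _ hbK ^ ℓ := by
    ext
    rw [Units.val_mk0, Units.val_mul, Units.val_pow_eq_pow_val, Units.val_mk0, ← hx, hr, map_mul,
      map_pow, ← Nat.sub_add_cancel hℓ.one_le, Nat.add_sub_cancel, pow_succ]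
    field_simp
  rw [← hclass _ _ _ hrx] at hz ⊢
  rw [powClass_mem_selmer] at hz
  obtain ⟨I, hI⟩ := exists_pow_eq_span_singleton (ℓ := ℓ) hr0 fun v => by
    have h1 := hz v (by rintro ⟨q, hq, -⟩; simp at hq)
    have h2 : v.valuationOfNeZero (Units.mk0 _ hrK) =
        Multiplicative.ofAdd (-(multiplicity v.asIdeal (Ideal.span {r}) : ℤ)) := by
      rw [← WithZero.coe_inj, HeightOneSpectrum.valuationOfNeZero_eq, Units.val_mk0,
        HeightOneSpectrum.valuation_of_algebraMap,
        HeightOneSpectrum.intValuation_eq_exp_neg_multiplicity _ hr0]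
      rfl
    rw [h2, toAdd_ofAdd, dvd_neg] at h1
    exact_mod_cast h1
  -- The class of `I` is killed by `ℓ`, which is prime to the class number.
  have hIp : I.IsPrincipal := by
    refine Ideal.IsPrincipal.of_isPrincipal_pow_of_coprime (n := ℓ) ?_ ⟨r, hI⟩
    exact (Nat.Prime.coprime_iff_not_dvd hℓ).2 hh
  obtain ⟨c, hc⟩ := hIp
  have hc' : Ideal.span {c ^ ℓ} = Ideal.span {r} := by
    rw [← hI, hc, ← Ideal.span_singleton_pow]
  obtain ⟨u, hu⟩ := Ideal.span_singleton_eq_span_singleton.1 hc'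
  have hc0 : algebraMap (𝓞 K) K c ≠ 0 := by
    intro h
    rw [map_eq_zero_iff _ (FaithfulSMul.algebraMap_injective (𝓞 K) K)] at h
    rw [h, zero_pow hℓ.ne_zero, zero_mul] at hu
    exact hr0 hu.symm
  refine ⟨u, (hclass _ (Units.mk0 _ hc0) _ ?_).symm⟩
  ext
  rw [Units.val_mk0, Units.val_mul, Units.val_pow_eq_pow_val, Units.val_mk0, ← hu, map_mul,
    map_pow, mul_comm]
  rfl

end Units

/-! ### The contribution of roots of unity -/

section Torsion

variable {K : Type*} [Field K] [NumberField K] {ℓ : ℕ}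

variable (K) in
theorem exists_torsion_generator :
    ∃ ζ ∈ Units.torsion K, ∀ t ∈ Units.torsion K, ∃ k : ℤ, t = ζ ^ k := by
  obtain ⟨⟨ζ, hζ⟩, h⟩ := IsCyclic.exists_generator (α := Units.torsion K)
  refine ⟨ζ, hζ, fun t ht => ?_⟩
  obtain ⟨k, hk⟩ := Subgroup.mem_zpowers_iff.1 (h ⟨t, ht⟩)
  exact ⟨k, by simpa using (congrArg Subtype.val hk).symm⟩

omit [NumberField K] in
theorem mem_torsion_of_pow_eq_one {u : (𝓞 K)ˣ} {m : ℕ} (hm : m ≠ 0) (h : u ^ m = 1) :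
    u ∈ Units.torsion K :=
  (CommGroup.mem_torsion _).2 (isOfFinOrder_iff_pow_eq_one.2 ⟨m, Nat.pos_of_ne_zero hm, h⟩)

/-- The action of the Galois group on units. -/
noncomputable abbrev galUnit (σ : Gal(K/ℚ)) : (𝓞 K)ˣ →* (𝓞 K)ˣ :=
  Units.map (MulSemiringAction.toRingHom Gal(K/ℚ) (𝓞 K) σ : 𝓞 K →* 𝓞 K)

theorem coe_galUnit (σ : Gal(K/ℚ)) (u : (𝓞 K)ˣ) : ((galUnit σ u : (𝓞 K)ˣ) : K) = σ (u : K) := rfl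

theorem galUnit_mem_torsion {t : (𝓞 K)ˣ} (ht : t ∈ Units.torsion K) (σ : Gal(K/ℚ)) :
    galUnit σ t ∈ Units.torsion K :=
  (CommGroup.mem_torsion _).2 ((galUnit σ).isOfFinOrder ((CommGroup.mem_torsion _).1 ht))

omit [NumberField K] in
theorem intCast_smul_unitClass (k : ℤ) (u : (𝓞 K)ˣ) :
    (k : ZMod ℓ) • unitClass ℓ u = unitClass ℓ (u ^ k) := by
  rw [intCast_smul, unitClass_zpow]

variable [Fact ℓ.Prime]

/-- If `ℓ` is prime to the order of `ζ`, then `ζ` is an `ℓ`-th power of one of its own powers. -/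
theorem dvd_orderOf_of_unitClass_ne_zero {ζ : (𝓞 K)ˣ} (h : unitClass ℓ ζ ≠ 0) :
    ℓ ∣ orderOf ζ := by
  by_contra hℓ
  have hcop : (orderOf ζ).Coprime ℓ := ((Nat.Prime.coprime_iff_not_dvd Fact.out).2 hℓ).symm
  obtain ⟨m, hm⟩ := exists_pow_eq_self_of_coprime hcop.symm
  exact h (unitClass_eq_zero_iff.2 ⟨ζ ^ m, by rw [← pow_mul, mul_comm, pow_mul, hm]⟩)

omit [NumberField K] [Fact ℓ.Prime] in
theorem isPrimitiveRoot_pow_div {ζ : (𝓞 K)ˣ} (hζ : ζ ∈ Units.torsion K) (h : ℓ ∣ orderOf ζ) :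
    IsPrimitiveRoot (ζ ^ (orderOf ζ / ℓ)) ℓ := by
  have h0 : orderOf ζ ≠ 0 := ((CommGroup.mem_torsion _).1 hζ).orderOf_pos.ne'
  refine (IsPrimitiveRoot.orderOf ζ).pow (Nat.pos_of_ne_zero h0) ?_
  rw [Nat.div_mul_cancel h]

variable {χ : Gal(K/ℚ) →* (ZMod ℓ)ˣ}

omit [NumberField K] in
theorem zpow_eq_pow_iff_of_isPrimitiveRoot {η : (𝓞 K)ˣ} (hη : IsPrimitiveRoot η ℓ) {k : ℤ}
    {a : ZMod ℓ} : η ^ k = η ^ a.val ↔ (k : ZMod ℓ) = a := by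
  rw [← zpow_natCast, zpow_eq_zpow_iff_modEq, ← hη.eq_orderOf, ← ZMod.intCast_eq_intCast_iff,
    Int.cast_natCast, ZMod.natCast_zmod_val]

/-- If the root of unity `ζ` of `K` is not an `ℓ`-th power and its class lies in the
`χ`-isotypic part then `K = ℚ(μ_ℓ)` and `χ` is the cyclotomic character. -/
theorem isStandardCyclotomic_of_unitClass [IsGalois ℚ K] (hχ : Function.Injective χ)
    {ζ : (𝓞 K)ˣ} (hζ : ζ ∈ Units.torsion K)
    (hgen : ∀ t ∈ Units.torsion K, ∃ k : ℤ, t = ζ ^ k) (h0 : unitClass ℓ ζ ≠ 0)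
    (hact : ∀ σ, galAct ℓ σ (unitClass ℓ ζ) = (χ σ : ZMod ℓ) • unitClass ℓ ζ) :
    IsStandardCyclotomic K ℓ χ := by
  have hℓ : ℓ.Prime := Fact.out
  have hprim := isPrimitiveRoot_pow_div hζ (dvd_orderOf_of_unitClass_ne_zero h0)
  set η := ζ ^ (orderOf ζ / ℓ) with hη
  have hprimK : IsPrimitiveRoot (η : K) ℓ := IsPrimitiveRoot.coe_coe_iff.2 hprim
  -- If `σ ζ = ζ ^ k`, comparing classes gives `k = χ σ` mod `ℓ`; this fixes the action on `η`, a
  -- power of `ζ` of order `ℓ`.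
  have hση (σ : Gal(K/ℚ)) : σ (η : K) = (η : K) ^ (χ σ : ZMod ℓ).val := by
    obtain ⟨k, hk⟩ := hgen _ (galUnit_mem_torsion hζ σ)
    have h1 := hact σ
    rw [galAct_unitClass, show Units.map _ ζ = ζ ^ k from hk, ← intCast_smul_unitClass] at h1
    have h2 := smul_left_injective _ h0 h1
    have h3 : galUnit σ η = η ^ (χ σ : ZMod ℓ).val := by
      rw [← (zpow_eq_pow_iff_of_isPrimitiveRoot hprim).2 h2, hη, map_pow, hk, ← zpow_natCast,
        zpow_comm, zpow_natCast]
    rw [← coe_galUnit, h3, Units.coe_pow]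
  refine ⟨?_, fun σ ξ hξ => ?_⟩
  -- By Galois theory: an automorphism fixing `η` has `χ σ = 1`, hence is trivial.
  · have htop : IntermediateField.adjoin ℚ {(η : K)} = ⊤ := by
      rw [← IsGalois.fixedField_fixingSubgroup (IntermediateField.adjoin ℚ {(η : K)}),
        ← IntermediateField.fixedField_bot]
      congr 1
      rw [Subgroup.eq_bot_iff_forall]
      intro σ hσ
      have h1 : σ (η : K) = η := (IntermediateField.mem_fixingSubgroup_iff _ _).1 hσ _
        (IntermediateField.mem_adjoin_simple_self ℚ (η : K))
      rw [hση] at h1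
      have h2 : η ^ (1 : ℤ) = η ^ (χ σ : ZMod ℓ).val := by
        rw [zpow_one]
        exact Units.coe_injective K (h1.symm.trans (Units.coe_pow _ _).symm)
      rw [zpow_eq_pow_iff_of_isPrimitiveRoot hprim, Int.cast_one] at h2
      exact hχ (by rw [map_one]; exact Units.ext h2.symm)
    have : NeZero ℓ := ⟨hℓ.ne_zero⟩
    have := hprimK.intermediateField_adjoin_isCyclotomicExtension ℚ
    exact IsCyclotomicExtension.equiv {ℓ} ℚ _
      ((IntermediateField.equivOfEq htop).trans IntermediateField.topEquiv)
  · have : NeZero ℓ := ⟨hℓ.ne_zero⟩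
    obtain ⟨i, -, rfl⟩ := hprimK.eq_pow_of_pow_eq_one hξ
    rw [map_pow, hση, ← pow_mul, ← pow_mul, mul_comm]

/-- If `K = ℚ(μ_ℓ)` and `χ` is the cyclotomic character then the generators of the group of
roots of unity of `K` are not `ℓ`-th powers, and their classes lie in the `χ`-isotypic part. -/
theorem unitClass_of_isStandardCyclotomic (h : IsStandardCyclotomic K ℓ χ)
    {ζ : (𝓞 K)ˣ} (hζ : ζ ∈ Units.torsion K)
    (hgen : ∀ t ∈ Units.torsion K, ∃ k : ℤ, t = ζ ^ k) :
    unitClass ℓ ζ ≠ 0 ∧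
      ∀ σ, galAct ℓ σ (unitClass ℓ ζ) = (χ σ : ZMod ℓ) • unitClass ℓ ζ := by
  have hℓ : ℓ.Prime := Fact.out
  have : NeZero ℓ := ⟨hℓ.ne_zero⟩
  obtain ⟨hcyc, hact⟩ := h
  obtain ⟨ξ, hξ⟩ := IsCyclotomicExtension.exists_isPrimitiveRoot ℚ K (Set.mem_singleton ℓ)
    hℓ.ne_zero
  obtain ⟨η, hη⟩ : ∃ η : (𝓞 K)ˣ, (η : K) = ξ :=
    ⟨hξ.toInteger_isPrimitiveRoot.isUnit hℓ.ne_zero |>.unit, rfl⟩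
  rw [← hη] at hξ
  have hprim : IsPrimitiveRoot η ℓ := IsPrimitiveRoot.coe_coe_iff.1 hξ
  have hdvd : ℓ ∣ orderOf ζ := by
    obtain ⟨i, hi⟩ := hgen η (mem_torsion_of_pow_eq_one hℓ.ne_zero hprim.pow_eq_one)
    rw [hprim.eq_orderOf, hi]
    exact orderOf_dvd_of_mem_zpowers ⟨i, rfl⟩
  refine ⟨fun h0 => ?_, fun σ => ?_⟩
  -- An `ℓ`-th root of `ζ` would be some `ζ ^ j` with `ℓ * j ≡ 1` modulo the order of `ζ`, a
  -- multiple of `ℓ`.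
  · obtain ⟨w, hw⟩ := unitClass_eq_zero_iff.1 h0
    have hwt : w ∈ Units.torsion K := by
      refine mem_torsion_of_pow_eq_one (m := ℓ * orderOf ζ) ?_ ?_
      · exact mul_ne_zero hℓ.ne_zero ((CommGroup.mem_torsion _).1 hζ).orderOf_pos.ne'
      · rw [pow_mul, hw, pow_orderOf_eq_one]
    obtain ⟨j, rfl⟩ := hgen w hwt
    rw [← zpow_natCast, ← zpow_mul] at hw
    nth_rw 2 [← zpow_one ζ] at hw
    rw [zpow_eq_zpow_iff_modEq] at hw
    have h2 := hw.of_dvd (Int.natCast_dvd_natCast.2 hdvd)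
    rw [← ZMod.intCast_eq_intCast_iff] at h2
    simp at h2
  · obtain ⟨k, hk⟩ := hgen _ (galUnit_mem_torsion hζ σ)
    have h1 : galUnit σ η = η ^ k := by
      obtain ⟨i, rfl⟩ := hgen η (mem_torsion_of_pow_eq_one hℓ.ne_zero hprim.pow_eq_one)
      rw [map_zpow, hk, zpow_comm]
    have h2 : η ^ k = η ^ (χ σ : ZMod ℓ).val := by
      rw [← h1]
      apply Units.coe_injective K
      exact (hact σ _ hξ.pow_eq_one).trans (Units.coe_pow _ _).symm
    rw [galAct_unitClass, show Units.map _ ζ = ζ ^ k from hk, ← intCast_smul_unitClass,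
      (zpow_eq_pow_iff_of_isPrimitiveRoot hprim).1 h2]

/-- If the `χ`-isotypic part of `K(∅, ℓ)` comes from roots of unity, then it is a line if
`K = ℚ(μ_ℓ)` and `χ` is the cyclotomic character, and is zero otherwise. -/
theorem finrank_selmerOne_empty_of_torsion [IsGalois ℚ K] (hχ : Function.Injective χ)
    (H : ∀ z ∈ selmerOne K ∅ ℓ χ, ∃ t ∈ Units.torsion K, unitClass ℓ t = z) :
    Module.Finite (ZMod ℓ) (selmerOne K ∅ ℓ χ) ∧
      (IsStandardCyclotomic K ℓ χ → Module.finrank (ZMod ℓ) (selmerOne K ∅ ℓ χ) = 1) ∧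
      (¬ IsStandardCyclotomic K ℓ χ → Module.finrank (ZMod ℓ) (selmerOne K ∅ ℓ χ) = 0) := by
  obtain ⟨ζ, hζ, hgen⟩ := exists_torsion_generator K
  have H' (z) (hz : z ∈ selmerOne K ∅ ℓ χ) : ∃ c : ZMod ℓ, c • unitClass ℓ ζ = z := by
    obtain ⟨t, ht, rfl⟩ := H z hz
    obtain ⟨k, rfl⟩ := hgen t ht
    exact ⟨k, intCast_smul_unitClass k ζ⟩
  by_cases hstd : IsStandardCyclotomic K ℓ χ
  · obtain ⟨h0, hact⟩ := unitClass_of_isStandardCyclotomic hstd hζ hgen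
    have h1 : Module.finrank (ZMod ℓ) (selmerOne K ∅ ℓ χ) = 1 := by
      refine finrank_eq_one (⟨unitClass ℓ ζ, unitClass_mem_selmer ∅ ζ, hact⟩ : selmerOne K ∅ ℓ χ)
        (fun h => h0 (congrArg Subtype.val h)) fun w => ?_
      obtain ⟨c, hc⟩ := H' w.1 w.2
      exact ⟨c, Subtype.ext hc⟩
    exact ⟨Module.finite_of_finrank_eq_succ h1, fun _ => h1, fun h => absurd hstd h⟩
  · have : Subsingleton (selmerOne K ∅ ℓ χ) := by
      refine subsingleton_of_forall_eq 0 fun w => ?_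
      by_contra hw
      obtain ⟨c, hc⟩ := H' w.1 w.2
      have hw0 : (w : PowQuot K ℓ) ≠ 0 := fun h => hw (Subtype.ext h)
      have hc0 : c ≠ 0 := by
        rintro rfl
        exact hw0 (by rw [← hc, zero_smul])
      have hζ0 : unitClass ℓ ζ ≠ 0 := fun h => hw0 (by rw [← hc, h, smul_zero])
      refine hstd (isStandardCyclotomic_of_unitClass hχ hζ hgen hζ0 fun σ => ?_)
      have h1 := w.2.2 σ
      rw [← hc, galAct_smul, smul_comm] at h1
      exact smul_right_injective _ hc0 h1
    exact ⟨inferInstance, fun h => absurd h hstd, fun _ => Module.finrank_zero_of_subsingleton⟩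

end Torsion

/-! ### Fields that are `ℚ` or not totally real -/

section NotReal

variable {K : Type*} [Field K] [NumberField K] {ℓ : ℕ}

/-- There is a single infinite place, so the unit rank is zero. -/
theorem mem_torsion_of_finrank_eq_one (h : Module.finrank ℚ K = 1) (u : (𝓞 K)ˣ) :
    u ∈ Units.torsion K := by
  have hr : Units.rank K = 0 := by
    have h1 := InfinitePlace.card_add_two_mul_card_eq_rank K
    have h2 := InfinitePlace.card_eq_nrRealPlaces_add_nrComplexPlaces K
    rw [Units.rank]
    omega
  obtain ⟨⟨ζ, e⟩, hζ, -⟩ := Units.exist_unique_eq_mul_prod K u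
  have : IsEmpty (Fin (Units.rank K)) := by rw [hr]; infer_instance
  rw [hζ]
  simp

variable [Fact ℓ.Prime] {χ : Gal(K/ℚ) →* (ZMod ℓ)ˣ}

theorem ne_two_of_finrank_ne_one [IsGalois ℚ K] (hχ : Function.Injective χ)
    (h : Module.finrank ℚ K ≠ 1) : ℓ ≠ 2 := by
  rintro rfl
  apply h
  rw [← IsGalois.card_aut_eq_finrank]
  have : Subsingleton Gal(K/ℚ) := hχ.subsingleton
  exact Nat.card_of_subsingleton 1

/-- Complex conjugation acts as `-1` on the `χ`-isotypic part of the units modulo `ℓ`-th powers,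
and `u / ū` is a root of unity for all units `u`. -/
theorem exists_torsion_unitClass_eq_of_not_isTotallyReal [IsGalois ℚ K]
    (hχ : Function.Injective χ) (hh : ¬ ℓ ∣ classNumber K) (hK : ¬ IsTotallyReal K)
    {z : PowQuot K ℓ} (hz : z ∈ selmerOne K ∅ ℓ χ) :
    ∃ t ∈ Units.torsion K, unitClass ℓ t = z := by
  have hcomm (σ τ : Gal(K/ℚ)) : σ * τ = τ * σ := hχ (by rw [map_mul, map_mul, mul_comm])
  obtain ⟨w, hw⟩ : ∃ w : InfinitePlace K, ¬ w.IsReal := by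
    by_contra! h
    exact hK ⟨h⟩
  have hram : w.IsRamified ℚ := by
    rw [InfinitePlace.isRamified_iff]
    exact ⟨InfinitePlace.not_isReal_iff_isComplex.1 hw, IsTotallyReal.isReal _⟩
  rw [InfinitePlace.isRamified_iff_card_stabilizer_eq_two] at hram
  obtain ⟨c, hc1⟩ : ∃ c : MulAction.stabilizer Gal(K/ℚ) w, c ≠ 1 := by
    have : Nontrivial (MulAction.stabilizer Gal(K/ℚ) w) :=
      Finite.one_lt_card_iff_nontrivial.1 (by omega)
    exact exists_ne 1
  obtain ⟨c, hcw⟩ := c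
  have hcc : c ^ 2 = 1 := by
    have := pow_card_eq_one' (x := (⟨c, hcw⟩ : MulAction.stabilizer Gal(K/ℚ) w))
    rw [hram] at this
    exact congrArg Subtype.val this
  have hχc : (χ c : ZMod ℓ) = -1 := by
    have h1 : (χ c : ZMod ℓ) ^ 2 = 1 := by
      rw [← Units.val_pow_eq_pow_val, ← map_pow, hcc, map_one, Units.val_one]
    refine (mul_self_eq_one_iff.1 (by rwa [← sq])).resolve_left fun h => hc1 ?_
    exact Subtype.ext (hχ (by rw [Units.ext_iff, h, OneMemClass.coe_one, map_one, Units.val_one]))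
  -- All places are conjugate to `w` and the Galois group is abelian, so `c` fixes each of them.
  have hplace (v : InfinitePlace K) (x : K) : v (c x) = v x := by
    obtain ⟨τ, rfl⟩ := InfinitePlace.exists_smul_eq_of_comap_eq (k := ℚ) (w := w) (w' := v)
      (Subsingleton.elim _ _)
    have h1 : c⁻¹ • τ • w = τ • w := by
      rw [← mul_smul, hcomm, mul_smul, inv_smul_eq_iff.2 (MulAction.mem_stabilizer_iff.1 hcw).symm]
    conv_rhs => rw [← h1]
    rfl
  obtain ⟨u, rfl⟩ := exists_unitClass_eq hh hz.1
  have ht : u * (galUnit c u)⁻¹ ∈ Units.torsion K := by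
    rw [Units.mem_torsion]
    intro v
    have h0 : v (u : K) ≠ 0 := by simp
    have h1 : ((u * (galUnit c u)⁻¹ : (𝓞 K)ˣ) : K) * c (u : K) = u := by
      rw [← coe_galUnit, ← Units.coe_mul, inv_mul_cancel_right]
    have h2 := congrArg v h1
    rw [map_mul, hplace] at h2
    exact mul_right_cancel₀ h0 (h2.trans (one_mul _).symm)
  have hodd : ℓ ≠ 2 := by
    rintro rfl
    apply hc1
    have : Subsingleton Gal(K/ℚ) := hχ.subsingleton
    exact Subsingleton.elim _ _
  obtain ⟨m, hm⟩ := (Fact.out : ℓ.Prime).odd_of_ne_two hodd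
  -- Since `c` acts as `-1`, the class of `u / c u` is `2 • z`; the exponent `m + 1 = (ℓ + 1) / 2`
  -- inverts `2` mod `ℓ`.
  refine ⟨_, pow_mem ht (m + 1), ?_⟩
  rw [unitClass_pow, unitClass_mul_inv, ← galAct_unitClass, hz.2 c, hχc, neg_one_smul, sub_neg_eq_add,
    ← two_nsmul, smul_smul, ← natCast_smul]
  have : (((m + 1) * 2 : ℕ) : ZMod ℓ) = 1 := by
    have h1 : (m + 1) * 2 = ℓ + 1 := by omega
    rw [h1, Nat.cast_add, ZMod.natCast_self, zero_add, Nat.cast_one]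
  rw [this, one_smul]

end NotReal

/-! ### The Galois module of units modulo torsion -/

section Lattice

variable {K : Type*} [Field K] [NumberField K]

/-- The units of `𝓞 K` modulo roots of unity, written additively. -/
def UnitLattice (K : Type*) [Field K] [NumberField K] : Type _ :=
  Additive ((𝓞 K)ˣ ⧸ Units.torsion K)

instance unitLatticeAddCommGroup (K : Type*) [Field K] [NumberField K] :
    AddCommGroup (UnitLattice K) :=
  inferInstanceAs (AddCommGroup (Additive ((𝓞 K)ˣ ⧸ Units.torsion K)))

instance : Module.Free ℤ (UnitLattice K) := Module.Free.of_basis (Units.basisModTorsion K)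

instance : Module.Finite ℤ (UnitLattice K) := Module.Finite.of_basis (Units.basisModTorsion K)

variable (K) in
theorem finrank_unitLattice : Module.finrank ℤ (UnitLattice K) = Units.rank K :=
  Units.finrank_modTorsion K

/-- The class of a unit modulo roots of unity. -/
def unitMk (u : (𝓞 K)ˣ) : UnitLattice K := Additive.ofMul (QuotientGroup.mk u)

theorem unitMk_surjective : Function.Surjective (unitMk : (𝓞 K)ˣ → UnitLattice K) :=
  fun x => QuotientGroup.mk_surjective (Additive.toMul x)

theorem unitMk_pow (u : (𝓞 K)ˣ) (m : ℕ) : unitMk (u ^ m) = m • unitMk u := rfl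

theorem unitMk_eq_zero_iff {u : (𝓞 K)ˣ} : unitMk u = 0 ↔ u ∈ Units.torsion K :=
  QuotientGroup.eq_one_iff u

/-- The action of an automorphism on the units modulo roots of unity. -/
noncomputable def galLattice (σ : Gal(K/ℚ)) : UnitLattice K →ₗ[ℤ] UnitLattice K :=
  AddMonoidHom.toIntLinearMap (MonoidHom.toAdditive
    (QuotientGroup.map (Units.torsion K) (Units.torsion K) (galUnit σ)
      fun _ ht => galUnit_mem_torsion ht σ))

theorem galLattice_unitMk (σ : Gal(K/ℚ)) (u : (𝓞 K)ˣ) :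
    galLattice σ (unitMk u) = unitMk (galUnit σ u) := rfl

/-- The logarithm of the absolute value at the infinite place `v`, as a linear form on the units
modulo roots of unity. -/
noncomputable def placeLog (v : InfinitePlace K) : UnitLattice K →ₗ[ℤ] ℝ :=
  AddMonoidHom.toIntLinearMap (MonoidHom.toAdditiveLeft (QuotientGroup.lift (Units.torsion K)
    { toFun := fun u => Multiplicative.ofAdd (Real.log (v (u : K)))
      map_one' := by simp
      map_mul' := fun u w => by
        rw [Units.coe_mul, map_mul, Real.log_mul (by simp) (by simp), ofAdd_add] }
    fun t ht => by
      have := (Units.mem_torsion K).1 ht v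
      simp [this]))

theorem placeLog_unitMk (v : InfinitePlace K) (u : (𝓞 K)ˣ) :
    placeLog v (unitMk u) = Real.log (v (u : K)) := rfl

theorem placeLog_galLattice (v : InfinitePlace K) (σ : Gal(K/ℚ)) (x : UnitLattice K) :
    placeLog v (galLattice σ x) = placeLog (σ⁻¹ • v) x := by
  obtain ⟨u, rfl⟩ := unitMk_surjective x
  rfl

theorem placeLog_galLattice_pow (v : InfinitePlace K) (σ : Gal(K/ℚ)) (i : ℕ)
    (x : UnitLattice K) :
    placeLog v ((galLattice σ ^ i) x) = placeLog (σ⁻¹ ^ i • v) x := by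
  induction i generalizing v with
  | zero => simp
  | succ i ih =>
    rw [pow_succ', Module.End.mul_apply, placeLog_galLattice, ih, ← mul_smul, ← pow_succ]

theorem eq_zero_of_placeLog_eq_zero {x : UnitLattice K} (h : ∀ v, placeLog v x = 0) : x = 0 := by
  obtain ⟨u, rfl⟩ := unitMk_surjective x
  rw [unitMk_eq_zero_iff, Units.mem_torsion]
  intro v
  have h1 := h v
  rw [placeLog_unitMk] at h1
  exact Real.eq_one_of_pos_of_log_eq_zero (Units.pos_at_place u v) h1

theorem sum_placeLog [IsTotallyReal K] (x : UnitLattice K) :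
    ∑ v : InfinitePlace K, placeLog v x = 0 := by
  obtain ⟨u, rfl⟩ := unitMk_surjective x
  rw [← Units.sum_mult_mul_log u]
  refine Finset.sum_congr rfl fun v _ => ?_
  rw [placeLog_unitMk, InfinitePlace.mult, if_pos (IsTotallyReal.isReal v), Nat.cast_one, one_mul]

variable [IsTotallyReal K]

/-- Real places are unramified over `ℚ`, so they have trivial stabilizers. -/
theorem smul_place_eq_iff {σ : Gal(K/ℚ)} {v : InfinitePlace K} : σ • v = v ↔ σ = 1 := by
  have h := (IsTotallyReal.isReal v).isUnramified (k := ℚ) |>.stabilizer_eq_bot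
  rw [← MulAction.mem_stabilizer_iff, h, Subgroup.mem_bot]

theorem card_infinitePlace_of_isTotallyReal :
    Fintype.card (InfinitePlace K) = Module.finrank ℚ K := by
  rw [← InfinitePlace.card_add_two_mul_card_eq_rank K,
    InfinitePlace.card_eq_nrRealPlaces_add_nrComplexPlaces K,
    IsTotallyReal.nrComplexPlaces_eq_zero]

variable {g : Gal(K/ℚ)}

theorem pow_smul_place_injOn (v : InfinitePlace K) :
    Set.InjOn (fun i : ℕ => g⁻¹ ^ i • v) (Finset.range (orderOf g)) := by
  intro i hi j hj hij
  have h1 : (g⁻¹ ^ j)⁻¹ * g⁻¹ ^ i = 1 := by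
    rw [← smul_place_eq_iff (v := v), mul_smul, inv_smul_eq_iff]
    exact hij
  rw [inv_mul_eq_one] at h1
  refine (pow_injOn_Iio_orderOf (x := g⁻¹) ?_ ?_ h1.symm)
  · simpa using hi
  · simpa using hj

/-- The action is free and there are exactly `n` places, so the powers of `g⁻¹` carry `v` to each
place once. -/
theorem sum_pow_smul_place (hg : orderOf g = Module.finrank ℚ K) (v : InfinitePlace K)
    (F : InfinitePlace K → ℝ) :
    ∑ i ∈ Finset.range (Module.finrank ℚ K), F (g⁻¹ ^ i • v) = ∑ w, F w := by
  classical
  rw [← hg, ← Finset.sum_image (g := fun i : ℕ => g⁻¹ ^ i • v) (pow_smul_place_injOn v)]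
  congr 1
  rw [← Finset.card_eq_iff_eq_univ, Finset.card_image_of_injOn (pow_smul_place_injOn v),
    Finset.card_range, hg, card_infinitePlace_of_isTotallyReal]

/-- The norm of a unit is `±1`: at each place the logarithm becomes the sum over all places, which
is zero. -/
theorem aeval_galLattice_geom_sum (hg : orderOf g = Module.finrank ℚ K) :
    aeval (galLattice g) (∑ i ∈ Finset.range (Module.finrank ℚ K), (X : ℤ[X]) ^ i) = 0 := by
  refine LinearMap.ext fun x => eq_zero_of_placeLog_eq_zero fun v => ?_
  simp only [map_sum, map_pow, aeval_X, LinearMap.sum_apply, placeLog_galLattice_pow]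
  rw [sum_pow_smul_place hg v fun w => placeLog w x, sum_placeLog]

/-- A unit that is small at all infinite places but one generates a free cyclic module over the
group ring modulo the norm. -/
theorem eq_zero_of_aeval_galLattice_eq_zero (hg : orderOf g = Module.finrank ℚ K) {P : ℤ[X]}
    (hP : P.degree < (Module.finrank ℚ K - 1 : ℕ)) (h : aeval (galLattice g) P = 0) :
    P = 0 := by
  set n := Module.finrank ℚ K with hn
  have hn0 : 0 < n := Module.finrank_pos
  obtain ⟨w₁⟩ : Nonempty (InfinitePlace K) := inferInstance
  obtain ⟨u, hu⟩ := Units.dirichletUnitTheorem.exists_unit K w₁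
  set a : ℕ → ℝ := fun j => placeLog (g⁻¹ ^ j • w₁) (unitMk u) with ha
  have hsum (k : ℕ) : ∑ i ∈ Finset.range n, a (i + k) = 0 := by
    simp only [ha, pow_add, mul_smul]
    rw [sum_pow_smul_place hg _ fun w => placeLog w (unitMk u), sum_placeLog]
  have hdeg : P.natDegree < n := by
    rcases eq_or_ne P 0 with rfl | hP0
    · simpa using hn0
    · rw [← natDegree_lt_iff_degree_lt hP0] at hP
      omega
  have hcoef (k : ℕ) : ∑ i ∈ Finset.range n, (P.coeff i : ℝ) * a (i + k) = 0 := by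
    have h1 : placeLog (g⁻¹ ^ k • w₁) (aeval (galLattice g) P (unitMk u)) = 0 := by
      rw [h, LinearMap.zero_apply, map_zero]
    rw [aeval_eq_sum_range' hdeg] at h1
    simpa [-inv_pow, LinearMap.sum_apply, placeLog_galLattice_pow, ← mul_smul, ← pow_add, ha]
      using h1
  -- Shift by `n - i₀`, where `P.coeff i₀` is maximal: among `i < n` only `i = i₀` then lands on
  -- `w₁`, and all other logarithms are negative.
  obtain ⟨i₀, hi₀, hmax⟩ := Finset.exists_max_image (Finset.range n) P.coeff ⟨0, by simpa⟩
  rw [Finset.mem_range] at hi₀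
  have hneg (i : ℕ) (hi : i < n) (hne : i ≠ i₀) : a (i + (n - i₀)) < 0 := by
    refine hu _ fun hw => ?_
    rw [smul_place_eq_iff, ← orderOf_dvd_iff_pow_eq_one, orderOf_inv, hg] at hw
    obtain ⟨d, hd⟩ := hw
    rcases Nat.lt_or_ge d 2 with hd2 | hd2
    · interval_cases d <;> omega
    · have := Nat.mul_le_mul_left n hd2
      omega
  -- A combination of `hcoef` and `hsum` with nonnegative terms; their vanishing makes all
  -- coefficients equal.
  have hzero : ∑ i ∈ Finset.range n,
      ((P.coeff i₀ : ℝ) - P.coeff i) * -a (i + (n - i₀)) = 0 := by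
    simp only [sub_mul, mul_neg, Finset.sum_sub_distrib, Finset.sum_neg_distrib, hcoef,
      ← Finset.mul_sum, hsum]
    simp
  rw [Finset.sum_eq_zero_iff_of_nonneg] at hzero
  swap
  · intro i hi
    rcases eq_or_ne i i₀ with rfl | hne
    · simp
    · refine mul_nonneg (sub_nonneg.2 (by exact_mod_cast hmax i hi)) ?_
      exact neg_nonneg.2 (hneg i (Finset.mem_range.1 hi) hne).le
  have hconst (i : ℕ) (hi : i < n) : P.coeff i = P.coeff i₀ := by
    rcases eq_or_ne i i₀ with rfl | hne
    · rfl
    have h1 := (mul_eq_zero.1 (hzero i (Finset.mem_range.2 hi))).resolve_right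
      (neg_ne_zero.2 (hneg i hi hne).ne)
    exact_mod_cast (sub_eq_zero.1 h1).symm
  ext i
  rw [coeff_zero]
  by_cases hi : i < n
  -- The common value is the coefficient of `X ^ (n - 1)`, which is zero by the degree bound.
  · rw [hconst i hi, ← hconst (n - 1) (by omega)]
    exact coeff_eq_zero_of_degree_lt hP
  · exact coeff_eq_zero_of_natDegree_lt (by omega)

/-- Both sides are monic of degree `n - 1` and annihilate `galLattice g`, so their difference has
smaller degree and is zero by `eq_zero_of_aeval_galLattice_eq_zero`. -/
theorem charpoly_galLattice (hg : orderOf g = Module.finrank ℚ K) :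
    (galLattice g).charpoly = ∑ i ∈ Finset.range (Module.finrank ℚ K), X ^ i := by
  set n := Module.finrank ℚ K with hn
  have hn0 : n ≠ 0 := Module.finrank_pos.ne'
  have hmonic : (∑ i ∈ Finset.range n, (X : ℤ[X]) ^ i).Monic := monic_geom_sum_X hn0
  have hdeg1 : (galLattice g).charpoly.degree = (n - 1 : ℕ) := by
    rw [degree_eq_natDegree (LinearMap.charpoly_monic _).ne_zero, LinearMap.charpoly_natDegree,
      finrank_unitLattice, Units.rank, card_infinitePlace_of_isTotallyReal]
  have hdeg2 : (∑ i ∈ Finset.range n, (X : ℤ[X]) ^ i).degree = (n - 1 : ℕ) := by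
    rw [degree_eq_natDegree hmonic.ne_zero]
    congr 1
    have h1 := congrArg natDegree (mul_geom_sum (X : ℤ[X]) n)
    rw [← C_1, natDegree_X_pow_sub_C, Monic.natDegree_mul (monic_X_sub_C 1) hmonic,
      natDegree_X_sub_C] at h1
    omega
  rw [← sub_eq_zero]
  refine eq_zero_of_aeval_galLattice_eq_zero hg ?_ ?_
  · rw [← hdeg1]
    exact degree_sub_lt_left (hdeg1.trans hdeg2.symm) (LinearMap.charpoly_monic _).ne_zero
      ((LinearMap.charpoly_monic _).leadingCoeff.trans hmonic.leadingCoeff.symm)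
  · rw [map_sub, LinearMap.aeval_self_charpoly, aeval_galLattice_geom_sum hg, sub_zero]

end Lattice

/-! ### Totally real fields other than `ℚ` -/

section TotallyReal

variable {K : Type*} [Field K] [NumberField K] [IsTotallyReal K] {ℓ : ℕ} [Fact ℓ.Prime]

/-- Otherwise `K` would contain a primitive `ℓ`-th root of unity with `ℓ > 2`, and would have no
real place. -/
theorem unitClass_eq_zero_of_mem_torsion (hℓ : ℓ ≠ 2) {t : (𝓞 K)ˣ} (ht : t ∈ Units.torsion K) :
    unitClass ℓ t = 0 := by
  by_contra h
  have h1 := isPrimitiveRoot_pow_div ht (dvd_orderOf_of_unitClass_ne_zero h)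
  have h2 := InfinitePlace.IsPrimitiveRoot.nrRealPlaces_eq_zero_of_two_lt (K := K) (k := ℓ) (
    lt_of_le_of_ne (Fact.out : ℓ.Prime).two_le hℓ.symm)
    (IsPrimitiveRoot.coe_coe_iff.2 h1)
  have h3 : 0 < Fintype.card (InfinitePlace K) := Fintype.card_pos
  rw [InfinitePlace.card_eq_nrRealPlaces_add_nrComplexPlaces, h2,
    IsTotallyReal.nrComplexPlaces_eq_zero] at h3
  exact lt_irrefl _ h3

variable (K) in
/-- The map from the units modulo roots of unity to `Kˣ / (Kˣ)^ℓ`. -/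
noncomputable def latticeClass (hℓ : ℓ ≠ 2) : UnitLattice K →ₗ[ℤ] PowQuot K ℓ :=
  AddMonoidHom.toIntLinearMap (MonoidHom.toAdditiveLeft (QuotientGroup.lift (Units.torsion K)
    { toFun := fun u => Multiplicative.ofAdd (unitClass ℓ u)
      map_one' := by
        rw [unitClass_eq_zero_of_mem_torsion hℓ (one_mem _)]; rfl
      map_mul' := fun u w => by rw [unitClass_mul, ofAdd_add] }
    fun t ht => by
      change Multiplicative.ofAdd (unitClass ℓ t) = 1
      rw [unitClass_eq_zero_of_mem_torsion hℓ ht]; rfl))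

theorem latticeClass_unitMk (hℓ : ℓ ≠ 2) (u : (𝓞 K)ˣ) :
    latticeClass K hℓ (unitMk u) = unitClass ℓ u := rfl

variable (K) in
/-- The map from the units modulo roots of unity, reduced modulo `ℓ`, to `Kˣ / (Kˣ)^ℓ`. -/
noncomputable def latticeModClass (hℓ : ℓ ≠ 2) :
    ZMod ℓ ⊗[ℤ] UnitLattice K →ₗ[ZMod ℓ] PowQuot K ℓ :=
  LinearMap.liftBaseChange (ZMod ℓ) (latticeClass K hℓ)

theorem latticeModClass_tmul (hℓ : ℓ ≠ 2) (u : (𝓞 K)ˣ) :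
    latticeModClass K hℓ (1 ⊗ₜ unitMk u) = unitClass ℓ u := by
  rw [latticeModClass, LinearMap.liftBaseChange_tmul, one_smul, latticeClass_unitMk]

omit [IsTotallyReal K] in
theorem exists_one_tmul_unitMk (y : ZMod ℓ ⊗[ℤ] UnitLattice K) :
    ∃ u : (𝓞 K)ˣ, (1 : ZMod ℓ) ⊗ₜ[ℤ] unitMk u = y := by
  obtain ⟨x, rfl⟩ : ∃ x : UnitLattice K, (1 : ZMod ℓ) ⊗ₜ[ℤ] x = y := by
    induction y using TensorProduct.induction_on with
    | zero => exact ⟨0, tmul_zero _ _⟩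
    | tmul a x =>
      obtain ⟨k, rfl⟩ := ZMod.intCast_surjective a
      exact ⟨k • x, by rw [← smul_tmul, zsmul_one]⟩
    | add y₁ y₂ h₁ h₂ =>
      obtain ⟨x₁, rfl⟩ := h₁
      obtain ⟨x₂, rfl⟩ := h₂
      exact ⟨x₁ + x₂, tmul_add _ _ _⟩
  obtain ⟨u, rfl⟩ := unitMk_surjective x
  exact ⟨u, rfl⟩

/-- A unit with trivial class is an `ℓ`-th power of a unit, hence a multiple of `ℓ` in the lattice.
-/
theorem latticeModClass_injective (hℓ : ℓ ≠ 2) :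
    Function.Injective (latticeModClass K hℓ) := by
  rw [injective_iff_map_eq_zero]
  intro y hy
  obtain ⟨u, rfl⟩ := exists_one_tmul_unitMk y
  rw [latticeModClass_tmul, unitClass_eq_zero_iff] at hy
  obtain ⟨w, rfl⟩ := hy
  rw [unitMk_pow, ← natCast_zsmul, ← smul_tmul, zsmul_one, Int.cast_natCast, ZMod.natCast_self,
    zero_tmul]

theorem galAct_latticeModClass (hℓ : ℓ ≠ 2) (σ : Gal(K/ℚ)) (y : ZMod ℓ ⊗[ℤ] UnitLattice K) :
    galAct ℓ σ (latticeModClass K hℓ y) =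
      latticeModClass K hℓ ((galLattice σ).baseChange (ZMod ℓ) y) := by
  obtain ⟨u, rfl⟩ := exists_one_tmul_unitMk y
  rw [LinearMap.baseChange_tmul, galLattice_unitMk, latticeModClass_tmul, latticeModClass_tmul,
    galAct_unitClass]

omit [IsTotallyReal K] in
theorem galAct_eq_smul_of_powers {χ : Gal(K/ℚ) →* (ZMod ℓ)ˣ} {g : Gal(K/ℚ)}
    (hg : ∀ σ, σ ∈ Submonoid.powers g) {z : PowQuot K ℓ}
    (hz : galAct ℓ g z = (χ g : ZMod ℓ) • z) (σ : Gal(K/ℚ)) :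
    galAct ℓ σ z = (χ σ : ZMod ℓ) • z := by
  obtain ⟨i, rfl⟩ := hg σ
  induction i with
  | zero => simp [galAct_one]
  | succ i ih =>
    dsimp only at ih ⊢
    rw [pow_succ, galAct_mul, hz, galAct_smul, ih, smul_smul, map_mul, Units.val_mul, mul_comm]

variable [IsGalois ℚ K] {χ : Gal(K/ℚ) →* (ZMod ℓ)ˣ}

theorem finrank_selmerOne_empty_of_isTotallyReal (hχ : Function.Injective χ)
    (hh : ¬ ℓ ∣ classNumber K) (hn : Module.finrank ℚ K ≠ 1) :
    Module.Finite (ZMod ℓ) (selmerOne K ∅ ℓ χ) ∧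
      Module.finrank (ZMod ℓ) (selmerOne K ∅ ℓ χ) = 1 := by
  have hℓ := ne_two_of_finrank_ne_one hχ hn
  have : IsCyclic Gal(K/ℚ) := isCyclic_of_injective χ hχ
  obtain ⟨g, hgen⟩ := IsCyclic.exists_monoid_generator (α := Gal(K/ℚ))
  have hg : orderOf g = Module.finrank ℚ K := by
    rw [← IsGalois.card_aut_eq_finrank]
    exact orderOf_eq_card_of_forall_mem_powers hgen
  set φ : Module.End (ZMod ℓ) (ZMod ℓ ⊗[ℤ] UnitLattice K) :=
    (galLattice g).baseChange (ZMod ℓ) with hφ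
  set μ : ZMod ℓ := (χ g : ZMod ℓ) with hμ
  have hchar : φ.charpoly = ∑ i ∈ Finset.range (Module.finrank ℚ K), X ^ i := by
    rw [hφ, LinearMap.charpoly_baseChange, charpoly_galLattice hg]
    simp [Polynomial.map_sum]
  have hmul : φ.charpoly * (X - 1) = X ^ Module.finrank ℚ K - 1 := by rw [hchar, geom_sum_mul]
  have hdvd : Module.finrank ℚ K ∣ ℓ - 1 := by
    rw [← hg, ← orderOf_injective χ hχ g, ← ZMod.card_units ℓ]
    exact orderOf_dvd_card
  have hn0 : (Module.finrank ℚ K : ZMod ℓ) ≠ 0 := by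
    rw [Ne, ZMod.natCast_eq_zero_iff]
    intro h
    have h1 := h.trans hdvd
    have h2 := (Fact.out : ℓ.Prime).two_le
    exact absurd (Nat.le_of_dvd (by omega) h1) (by omega)
  -- The polynomial divides `X ^ n - 1`, and `n ∣ ℓ - 1` is nonzero mod `ℓ`.
  have hsep : φ.charpoly.Separable :=
    (X_pow_sub_one_separable_iff.2 hn0).of_dvd ⟨_, hmul.symm⟩
  have hroot : φ.charpoly.IsRoot μ := by
    have h1 := congrArg (eval μ) hmul
    have h2 : μ ^ Module.finrank ℚ K = 1 := by
      rw [hμ, ← Units.val_pow_eq_pow_val, ← map_pow, ← hg, pow_orderOf_eq_one, map_one,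
        Units.val_one]
    have h3 : μ - 1 ≠ 0 := by
      rw [sub_ne_zero]
      intro h
      apply hn
      rw [← hg, orderOf_eq_one_iff]
      exact hχ (by rw [map_one]; exact Units.ext h)
    simpa [h2, h3] using h1
  -- The root `μ` is simple, which bounds the eigenspace above; being a root makes it nonzero.
  have hfinrank : Module.finrank (ZMod ℓ) (φ.eigenspace μ) = 1 := by
    refine le_antisymm ((LinearMap.finrank_eigenspace_le φ μ).trans
      (rootMultiplicity_le_one_of_separable hsep μ)) ?_
    rw [Nat.one_le_iff_ne_zero, Ne, Submodule.finrank_eq_zero]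
    exact Module.End.hasEigenvalue_iff.1
      ((Module.End.hasEigenvalue_iff_isRoot_charpoly _ _).2 hroot)
  have hmap : (φ.eigenspace μ).map (latticeModClass K hℓ) = selmerOne K ∅ ℓ χ := by
    ext z
    rw [Submodule.mem_map, mem_selmerOne_iff]
    constructor
    · rintro ⟨y, hy, rfl⟩
      rw [Module.End.mem_eigenspace_iff] at hy
      refine ⟨?_, galAct_eq_smul_of_powers hgen ?_⟩
      · obtain ⟨u, rfl⟩ := exists_one_tmul_unitMk y
        rw [latticeModClass_tmul]
        exact unitClass_mem_selmer ∅ u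
      · rw [galAct_latticeModClass, ← hφ, hy, map_smul]
    · rintro ⟨hz, hact⟩
      obtain ⟨u, rfl⟩ := exists_unitClass_eq hh hz
      refine ⟨1 ⊗ₜ unitMk u, ?_, latticeModClass_tmul hℓ u⟩
      rw [Module.End.mem_eigenspace_iff]
      apply latticeModClass_injective hℓ
      rw [hφ, ← galAct_latticeModClass, map_smul, latticeModClass_tmul, hact g]
  have e : φ.eigenspace μ ≃ₗ[ZMod ℓ] selmerOne K ∅ ℓ χ :=
    (Submodule.equivMapOfInjective _ (latticeModClass_injective hℓ) _).trans
      (LinearEquiv.ofEq _ _ hmap)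
  exact ⟨Module.Finite.equiv e, by rw [← e.finrank_eq, hfinrank]⟩

end TotallyReal

end KSl

/-! ### Assembly of the cases -/

open scoped Classical in
theorem mainTheorem6 (ℓ : ℕ) [Fact ℓ.Prime]
    (K : Type*) [Field K] [NumberField K] [IsGalois ℚ K]
    (χ : Gal(K/ℚ) →* (ZMod ℓ)ˣ) (hχ : Function.Injective χ)
    (S : Finset ℕ) (hS : ∀ p ∈ S, p.Prime)
    (hh : ¬ ℓ ∣ NumberField.classNumber K) :
    Module.Finite (ZMod ℓ) (KSl.selmerOne K S ℓ χ) ∧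
    (((NumberField.IsTotallyReal K ∧ Module.finrank ℚ K ≠ 1) ∨ KSl.IsStandardCyclotomic K ℓ χ) →
      Module.finrank (ZMod ℓ) (KSl.selmerOne K S ℓ χ) =
        (S.filter (fun p => KSl.TotallySplit K p)).card + 1) ∧
    (¬ ((NumberField.IsTotallyReal K ∧ Module.finrank ℚ K ≠ 1) ∨
        KSl.IsStandardCyclotomic K ℓ χ) →
      Module.finrank (ZMod ℓ) (KSl.selmerOne K S ℓ χ) =
        (S.filter (fun p => KSl.TotallySplit K p)).card) := by
  by_cases hreal : NumberField.IsTotallyReal K ∧ Module.finrank ℚ K ≠ 1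
  · have := hreal.1
    obtain ⟨hfin, h1⟩ := KSl.finrank_selmerOne_empty_of_isTotallyReal hχ hh hreal.2
    obtain ⟨hfin', h2⟩ := KSl.finrank_selmerOne_eq_add hχ S hS hh
    exact ⟨hfin', fun _ => by rw [h2, h1], fun h => absurd (Or.inl hreal) h⟩
  · have H (z) (hz : z ∈ KSl.selmerOne K ∅ ℓ χ) :
        ∃ t ∈ NumberField.Units.torsion K, KSl.unitClass ℓ t = z := by
      by_cases hn : Module.finrank ℚ K = 1
      · obtain ⟨u, hu⟩ := KSl.exists_unitClass_eq hh hz.1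
        exact ⟨u, KSl.mem_torsion_of_finrank_eq_one hn u, hu⟩
      · exact KSl.exists_torsion_unitClass_eq_of_not_isTotallyReal hχ hh
          (fun h => hreal ⟨h, hn⟩) hz
    obtain ⟨hfin, h1, h0⟩ := KSl.finrank_selmerOne_empty_of_torsion hχ H
    obtain ⟨hfin', h2⟩ := KSl.finrank_selmerOne_eq_add hχ S hS hh
    exact ⟨hfin', fun h => by rw [h2, h1 (h.resolve_left hreal)],
      fun h => by rw [h2, h0 fun hs => h (Or.inr hs), add_zero]⟩
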